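/- Let $n\ge 2$ and let $a:\mathbb R\to(0,\infty)$ be smooth with, as $t\to-\infty$, (i) $a(t)\to 0$, (ii) $\int_t^1\frac{ds}{a(s)}\to\infty$, (iii) $a(t)\int_t^1\frac{ds}{a(s)}\to\infty$. Let $M_1=(-\infty,1)\times\mathbb R^n$ carry the Lorentzian metric $g_1=-dt^2+a(t)^2\delta$ ($\delta$ the Euclidean metric), time-oriented by $\partial_t$. Put $\hat t(t)=-\ln\int_t^1\frac{ds}{a(s)}$ and, for $(t,x)\in M_1$, $r=|x|$ and $\omega=x/|x|\in\mathbb S^{n-1}$ (for $x\ne0$), and let $(T,R)$ be the unique pair with $-\frac\pi2<T<\frac\pi2$, $0\le R<\pi$, $T>R-\frac\pi2$ and $$e^{\hat t}=\frac{\sin T+\cos R}{\cos T},\qquad r=\frac{\sin R}{\sin T+\cos R}.$$ Timelike curves are piecewise smooth with timelike one-sided tangent vectors. A curve in $M_1$ is past inextendible if it has no limit in $M_1$ at the lower end of its parameter interval. $I^+(p,M_1)$ is the set of points of $M_1$ that can be reached from $p$ by a future directed timelike curve in $M_1$. For a future directed past inextendible timelike curve $\gamma$ in $M_1$ parameterized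 by $t$, let $\mathrm{TIF}(\gamma)=\bigcup_{t}I^+(\gamma(t),M_1)$, the union over all $t$ at which $\gamma$ is defined. (a) Let $\gamma$ be a future directed past inextendible timelike curve in $M_1$ parameterized by $t$. Then $\gamma$ is defined for all sufficiently negative $t$, and: (i) $T\circ\gamma(t)\to T_*$ as $t\to-\infty$ for some $T_*\in[-\frac\pi2,\frac\pi2)$. (ii) If $T_*=-\frac\pi2$, then $\mathrm{TIF}(\gamma)=M_1$. (iii) If $T_*\in(-\frac\pi2,\frac\pi2)$, then $\omega\circ\gamma(t)$ converges in $\mathbb S^{n-1}$ as $t\to-\infty$ (in particular $r\circ\gamma(t)>0$ for all sufficiently negative $t$). (b) Let $\gamma_1,\gamma_2$ be two future directed past inextendible timelike curves in $M_1$, both parameterized by $t$. Set $T_i=\lim_{t\to-\infty}T\circ\gamma_i(t)$, assume $T_i\in(-\frac\pi2,\frac\pi2)$ for $i=1,2$, and let $\omega_i\in\mathbb S^{n-1}$ be the limit of $\omega\circ\gamma_i(t)$ as $t\to-\infty$. (i) If $T_1=T_2$ and $\omega_1=\omega_2$, then $\mathrm{TIF}(\gamma_1)=\mathrm{TIF}(\gamma_2)$.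 (ii) If $T_1<T_2$ and $\omega_1=\omega_2$, then $\mathrm{TIF}(\gamma_1)\supsetneq\mathrm{TIF}(\gamma_2)$. (iii) If $\omega_1\neq\omega_2$, then $\mathrm{TIF}(\gamma_1)\neq\mathrm{TIF}(\gamma_2)$. -/

import Mathlib

open Real Set Filter Topology
open scoped ContDiff

namespace FLRW

/-- The spatial slice `ℝⁿ` with its Euclidean inner product. -/
abbrev Space (n : ℕ) : Type := EuclideanSpace ℝ (Fin n)

/-- The hypotheses on the scale factor: `a` is a smooth positive function on `ℝ` with
(i) `a(t) → 0`, (ii) `∫_t^1 ds / a(s) → ∞`, (iii) `a(t) ∫_t^1 ds / a(s) → ∞` as `t → -∞`. -/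
structure IsScaleFactor (a : ℝ → ℝ) : Prop where
  smooth : ContDiff ℝ ∞ a
  pos : ∀ t, 0 < a t
  tendsto_zero : Tendsto a atBot (𝓝 0)
  no_particle_horizon : Tendsto (fun t => ∫ s in t..1, 1 / a s) atBot atTop
  tendsto_mul : Tendsto (fun t => a t * ∫ s in t..1, 1 / a s) atBot atTop

/-- The Lorentzian metric `g = -dt² + a(t)² δ` on `ℝ × ℝⁿ`, at the point `p`. -/
noncomputable def metric {n : ℕ} (a : ℝ → ℝ) (p v w : ℝ × Space n) : ℝ :=
  -(v.1 * w.1) + a p.1 ^ 2 * inner ℝ v.2 w.2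

/-- The open submanifold `M₁ = (-∞, 1) × ℝⁿ`. -/
def M₁ (n : ℕ) : Set (ℝ × Space n) := {p | p.1 < 1}

/-- `v` is a timelike tangent vector at `p`, future directed for the time orientation `∂_t`. -/
def IsFutureTimelike {n : ℕ} (a : ℝ → ℝ) (p v : ℝ × Space n) : Prop :=
  metric a p v v < 0 ∧ metric a p v (1, 0) < 0

/-- `γ` is piecewise smooth on the interval `I`: to each side of every parameter it is smooth up to
and including that parameter.  (By compactness, there are then only finitely many break points in
each compact subinterval, and `γ` is continuous on `I`.) -/
def PiecewiseSmoothOn {n : ℕ} (γ : ℝ → ℝ × Space n) (I : Set ℝ) : Prop :=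
  ∀ s ∈ I, ∃ ε > 0, ContDiffOn ℝ ∞ γ (I ∩ Icc s (s + ε)) ∧ ContDiffOn ℝ ∞ γ (I ∩ Icc (s - ε) s)

/-- `γ`, restricted to the nondegenerate interval `I`, is a future directed timelike curve in the
region `U` of the spacetime: piecewise smooth, with future directed timelike one-sided tangent
vectors. -/
structure IsFutureTimelikeCurve {n : ℕ} (a : ℝ → ℝ) (U : Set (ℝ × Space n)) (I : Set ℝ)
    (γ : ℝ → ℝ × Space n) : Prop where
  ordConnected : I.OrdConnected
  nontrivial : I.Nontrivial
  mapsTo : MapsTo γ I U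
  piecewiseSmooth : PiecewiseSmoothOn γ I
  timelike_right : ∀ s ∈ I, (I ∩ Ioi s).Nonempty →
    IsFutureTimelike a (γ s) (derivWithin γ (Ici s) s)
  timelike_left : ∀ s ∈ I, (I ∩ Iio s).Nonempty →
    IsFutureTimelike a (γ s) (derivWithin γ (Iic s) s)

/-- `γ : I → U` has no past endpoint in `U`: it does not converge to a point of `U` as the parameter
goes down to the lower end of `I`. -/
def IsPastInextendible {n : ℕ} (U : Set (ℝ × Space n)) (I : Set ℝ)
    (γ : ℝ → ℝ × Space n) : Prop :=
  ∀ p ∈ U, ¬ Tendsto (fun s : I => γ s) atBot (𝓝 p)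

/-- A future directed past inextendible timelike curve in `M₁` parameterized by `t`, with
parameter interval `I`. -/
structure IsPastInextendibleTimelikeCurve {n : ℕ} (a : ℝ → ℝ) (I : Set ℝ)
    (γ : ℝ → ℝ × Space n) : Prop where
  curve : IsFutureTimelikeCurve a (M₁ n) I γ
  inextendible : IsPastInextendible (M₁ n) I γ
  param : ∀ t ∈ I, (γ t).1 = t

/-- The timelike future `I⁺(p, U)`: the points of `U` that are reached from `p` by a future directed
timelike curve in `U`. -/
def chronFuture {n : ℕ} (a : ℝ → ℝ) (U : Set (ℝ × Space n)) (p : ℝ × Space n) :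
    Set (ℝ × Space n) :=
  {q | ∃ γ : ℝ → ℝ × Space n, IsFutureTimelikeCurve a U (Icc 0 1) γ ∧ γ 0 = p ∧ γ 1 = q}

/-- The union of the timelike futures `I⁺(γ(t), M₁)` over all points of the curve `γ` on `I`. -/
def TIF {n : ℕ} (a : ℝ → ℝ) (I : Set ℝ) (γ : ℝ → ℝ × Space n) : Set (ℝ × Space n) :=
  ⋃ t ∈ I, chronFuture a (M₁ n) (γ t)

/-- The time function `t̂(t) = -ln ∫_t^1 ds / a(s)`. -/
noncomputable def tHat (a : ℝ → ℝ) (t : ℝ) : ℝ := -Real.log (∫ s in t..1, 1 / a s)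

/-- The coordinate `T` as a function of `t̂` and `r`; see `coords_iff` for the equations
that define it. -/
noncomputable def coordT (tau r : ℝ) : ℝ :=
  π / 2 + arctan (r - exp (-tau)) - arctan (r + exp (-tau))

/-- The coordinate `R` as a function of `t̂` and `r`; see `coords_iff` for the equations
that define it. -/
noncomputable def coordR (tau r : ℝ) : ℝ :=
  arctan (r + exp (-tau)) + arctan (r - exp (-tau))

/-- For `t̂ ∈ ℝ` and `r ≥ 0`, the pair `(coordT t̂ r, coordR t̂ r)` is the unique `(T, R)` with
`-π/2 < T < π/2`, `0 ≤ R < π`, `T > R - π/2` such that `e^t̂ = (sin T + cos R) / cos T` and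
`r = sin R / (sin T + cos R)`. -/
theorem coords_iff (tau r : ℝ) (hr : 0 ≤ r) (T R : ℝ) :
    ((T ∈ Ioo (-(π / 2)) (π / 2) ∧ R ∈ Ico 0 π ∧ R - π / 2 < T) ∧
      exp tau = (sin T + cos R) / cos T ∧ r = sin R / (sin T + cos R)) ↔
    T = coordT tau r ∧ R = coordR tau r := by
  have hpi := Real.pi_pos
  have key : ∀ A B : ℝ, 0 < cos A → 0 < cos B →
      ((sin (π / 2 + B - A) + cos (A + B)) = 2 * (cos A * cos B)) ∧
      (cos (π / 2 + B - A) = (tan A - tan B) * (cos A * cos B)) ∧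
      (sin (A + B) = (tan A + tan B) * (cos A * cos B)) := by
    intro A B hA hB
    have e : π / 2 + B - A = π / 2 - (A - B) := by ring
    rw [e, sin_pi_div_two_sub, cos_pi_div_two_sub, cos_sub, cos_add, sin_sub, sin_add,
      tan_eq_sin_div_cos, tan_eq_sin_div_cos]
    refine ⟨by ring, ?_, ?_⟩ <;> field_simp
  have hE : exp tau = 1 / exp (-tau) := by rw [exp_neg]; simp
  have hpos : 0 < exp (-tau) := exp_pos _
  constructor
  · rintro ⟨⟨⟨hT1, hT2⟩, ⟨hR1, hR2⟩, hTR⟩, h1, h2⟩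
    obtain ⟨A, hA⟩ : ∃ A, A = (R - T + π / 2) / 2 := ⟨_, rfl⟩
    obtain ⟨B, hB⟩ : ∃ B, B = (R + T - π / 2) / 2 := ⟨_, rfl⟩
    have eT : T = π / 2 + B - A := by rw [hA, hB]; ring
    have eR : R = A + B := by rw [hA, hB]; ring
    have cA : 0 < cos A := cos_pos_of_mem_Ioo ⟨by linarith, by linarith⟩
    have cB : 0 < cos B := cos_pos_of_mem_Ioo ⟨by linarith, by linarith⟩
    have cT : 0 < cos T := cos_pos_of_mem_Ioo ⟨by linarith, by linarith⟩
    obtain ⟨k1, k2, k3⟩ := key A B cA cB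
    have cc : 0 < cos A * cos B := mul_pos cA cB
    rw [← eT, ← eR] at k1
    rw [← eT] at k2
    rw [← eR] at k3
    have hd : 0 < tan A - tan B := by
      by_contra hcon
      have := mul_nonpos_of_nonpos_of_nonneg (not_lt.1 hcon) cc.le
      linarith
    rw [k1, k3] at h2
    rw [k1, k2, hE] at h1
    have e1 : 2 * exp (-tau) = tan A - tan B := by
      field_simp at h1
      linarith
    have e2 : 2 * r = tan A + tan B := by
      rw [h2]; field_simp
    have tA : arctan (r + exp (-tau)) = A := by
      rw [show r + exp (-tau) = tan A by linarith]
      exact arctan_tan (by linarith) (by linarith)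
    have tB : arctan (r - exp (-tau)) = B := by
      rw [show r - exp (-tau) = tan B by linarith]
      exact arctan_tan (by linarith) (by linarith)
    exact ⟨by rw [coordT, tA, tB, eT], by rw [coordR, tA, tB, eR]⟩
  · rintro ⟨rfl, rfl⟩
    unfold coordT coordR
    have hA1 := arctan_lt_pi_div_two (r + exp (-tau))
    have hB1 := neg_pi_div_two_lt_arctan (r - exp (-tau))
    have hAB : arctan (r - exp (-tau)) < arctan (r + exp (-tau)) :=
      arctan_strictMono (by linarith)
    have hBA : -arctan (r + exp (-tau)) ≤ arctan (r - exp (-tau)) := by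
      rw [← arctan_neg]; exact arctan_strictMono.monotone (by linarith)
    have cA := cos_arctan_pos (r + exp (-tau))
    have cB := cos_arctan_pos (r - exp (-tau))
    have tA := tan_arctan (r + exp (-tau))
    have tB := tan_arctan (r - exp (-tau))
    generalize arctan (r + exp (-tau)) = A at *
    generalize arctan (r - exp (-tau)) = B at *
    obtain ⟨k1, k2, k3⟩ := key A B cA cB
    refine ⟨⟨⟨by linarith, by linarith⟩, ⟨by linarith, by linarith⟩, by linarith⟩, ?_, ?_⟩
    · rw [k1, k2, tA, tB, hE]
      field_simp
      ring
    · rw [k1, k3, tA, tB]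
      field_simp
      ring

/-- The coordinate function `T` on `M₁`. -/
noncomputable def T {n : ℕ} (a : ℝ → ℝ) (p : ℝ × Space n) : ℝ := coordT (tHat a p.1) ‖p.2‖

/-- The angular coordinate `ω = x / |x|` on `M₁`.  Where `r = |x| = 0` it takes the value `0`, which
is not on the unit sphere; so a limit on the unit sphere is a limit of points with `r > 0`. -/
noncomputable def omega {n : ℕ} (p : ℝ × Space n) : Space n := ‖p.2‖⁻¹ • p.2

end FLRW

namespace FLRW

/-! In the conformal time `η = confTime a`, which decreases in `t`, the metric is conformal to
Minkowski space, so `q` lies in the future of `p` iff `‖x_q - x_p‖ < η(p) - η(q)`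
(`mem_chronFuture_iff`). Hence `r - η` is monotone along a timelike curve and, as `t → -∞`, tends to
`-∞` or to some real `u`. Since `r + η → ∞`, the limit of `T` is `-π/2` or `arctan u`.

If the limit is `-∞`, the triangle inequality puts every point in the TIF. If it is `u`, then `r →
∞`, the curve stays above the null hyperplanes `⟪ω(s), x⟫ - η = u` (`le_inner_omega`), and this
forces `ω` to converge to some `w`. The TIF is then the half space `⟪w, x⟫ - η > u`
(`TIF_eq_halfSpace`). Part (b) thus compares half spaces: moving `u` gives strict inclusion, and
different normals `w` give different sets. -/

/-- A continuous function whose right derivative is everywhere negative decreases strictly. -/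
theorem lt_of_right_deriv_neg {f f' : ℝ → ℝ} {b c : ℝ} (hbc : b < c)
    (hf : ContinuousOn f (Icc b c))
    (hf' : ∀ x ∈ Ico b c, HasDerivWithinAt f (f' x) (Ici x) x)
    (hneg : ∀ x ∈ Ico b c, f' x < 0) : f c < f b := by
  -- The boundary comparison theorem yields only `≤`; strictness comes from a point `y` just after
  -- `b` with `f y < f b`.
  have hb := (hf' b ⟨le_rfl, hbc⟩).mono Ioi_subset_Ici_self
  rw [hasDerivWithinAt_iff_tendsto_slope' self_notMem_Ioi] at hb
  have h1 := (tendsto_order.1 hb).2 0 (hneg b ⟨le_rfl, hbc⟩)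
  obtain ⟨y, hy1, hy2⟩ := (h1.and (Ioo_mem_nhdsGT hbc)).exists
  have hy3 : f y < f b := by
    rw [slope_def_field, div_neg_iff] at hy1
    rcases hy1 with h | h
    · linarith [hy2.1]
    · linarith
  refine lt_of_le_of_lt ?_ hy3
  have hsub : Ico y c ⊆ Ico b c := Ico_subset_Ico_left hy2.1.le
  exact image_le_of_deriv_right_lt_deriv_boundary (B := fun _ => f y) (B' := fun _ => 0)
    (hf.mono (Icc_subset_Icc_left hy2.1.le)) (fun x hx => hf' x (hsub hx)) le_rfl
    (fun x => hasDerivAt_const x _) (fun x hx _ => hneg x (hsub hx)) ⟨hy2.2.le, le_rfl⟩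

/-! ### Conformal time -/

/-- The conformal time `∫_t^1 ds / a(s)` that elapses between `t` and `1`. -/
noncomputable def confTime (a : ℝ → ℝ) (t : ℝ) : ℝ := ∫ s in t..1, 1 / a s

@[simp] theorem confTime_one (a : ℝ → ℝ) : confTime a 1 = 0 := by simp [confTime]

section ScaleFactor

variable {a : ℝ → ℝ} (ha : IsScaleFactor a)
include ha

theorem IsScaleFactor.contDiff_inv : ContDiff ℝ ∞ (fun s => 1 / a s) :=
  contDiff_const.div ha.smooth fun t => (ha.pos t).ne'

theorem IsScaleFactor.hasDerivAt_confTime (t : ℝ) : HasDerivAt (confTime a) (-(1 / a t)) t := by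
  have hc := ha.contDiff_inv.continuous
  exact intervalIntegral.integral_hasDerivAt_left (hc.intervalIntegrable _ _)
    hc.aestronglyMeasurable.stronglyMeasurableAtFilter hc.continuousAt

theorem IsScaleFactor.contDiff_confTime : ContDiff ℝ ∞ (confTime a) := by
  rw [contDiff_infty_iff_deriv]
  refine ⟨fun t => (ha.hasDerivAt_confTime t).differentiableAt, ?_⟩
  rw [show deriv (confTime a) = fun t => -(1 / a t) from
    funext fun t => (ha.hasDerivAt_confTime t).deriv]
  exact ha.contDiff_inv.neg

theorem IsScaleFactor.strictAnti_confTime : StrictAnti (confTime a) :=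
  strictAnti_of_deriv_neg fun t => by
    rw [(ha.hasDerivAt_confTime t).deriv]
    exact neg_neg_of_pos (one_div_pos.2 (ha.pos t))

theorem IsScaleFactor.confTime_pos {t : ℝ} (ht : t < 1) : 0 < confTime a t := by
  simpa using ha.strictAnti_confTime ht

theorem IsScaleFactor.T_eq {n : ℕ} {p : ℝ × Space n} (hp : p.1 < 1) :
    T a p = π / 2 + arctan (‖p.2‖ - confTime a p.1) - arctan (‖p.2‖ + confTime a p.1) := by
  have h : exp (-tHat a p.1) = confTime a p.1 := by
    rw [tHat, neg_neg]
    exact exp_log (ha.confTime_pos hp)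
  rw [T, coordT, h]

end ScaleFactor

/-! ### Timelike curves and the chronological future -/

section Curves

variable {n : ℕ} {a : ℝ → ℝ} {U : Set (ℝ × Space n)} {I : Set ℝ} {γ : ℝ → ℝ × Space n}

theorem IsFutureTimelike.fst_pos {p v : ℝ × Space n} (h : IsFutureTimelike a p v) : 0 < v.1 := by
  have := h.2
  simpa [metric] using this

theorem IsFutureTimelike.norm_lt (ha : IsScaleFactor a) {p v : ℝ × Space n}
    (h : IsFutureTimelike a p v) : ‖v.2‖ < v.1 / a p.1 := by
  have h1 := h.1
  have h2 := h.fst_pos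
  have h3 := ha.pos p.1
  rw [metric, real_inner_self_eq_norm_sq] at h1
  rw [lt_div_iff₀ h3]
  refine lt_of_pow_lt_pow_left₀ 2 h2.le ?_
  nlinarith

theorem IsFutureTimelikeCurve.continuousOn (h : IsFutureTimelikeCurve a U I γ) :
    ContinuousOn γ I := by
  intro s hs
  obtain ⟨ε, hε, h1, h2⟩ := h.piecewiseSmooth s hs
  have c1 := h1.continuousOn s ⟨hs, le_rfl, by linarith⟩
  have c2 := h2.continuousOn s ⟨hs, by linarith, le_rfl⟩
  refine (c1.union c2).mono_of_mem_nhdsWithin ?_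
  filter_upwards [self_mem_nhdsWithin,
    mem_nhdsWithin_of_mem_nhds (Icc_mem_nhds (show s - ε < s by linarith)
      (show s < s + ε by linarith))] with x hx hx'
  rcases le_total s x with h | h
  · exact Or.inl ⟨hx, h, hx'.2⟩
  · exact Or.inr ⟨hx, hx'.1, h⟩

theorem IsFutureTimelikeCurve.hasDerivWithinAt (h : IsFutureTimelikeCurve a U I γ) {s t : ℝ}
    (hs : s ∈ I) (ht : t ∈ I) (hst : s < t) :
    HasDerivWithinAt γ (derivWithin γ (Ici s) s) (Ici s) s := by
  obtain ⟨ε, hε, h1, -⟩ := h.piecewiseSmooth s hs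
  have d := (h1.differentiableOn (by simp)) s ⟨hs, le_rfl, by linarith⟩
  refine (d.mono_of_mem_nhdsWithin ?_).hasDerivWithinAt
  filter_upwards [Icc_mem_nhdsGE (lt_min hst (show s < s + ε by linarith))] with x hx
  exact ⟨h.ordConnected.out hs ht ⟨hx.1, hx.2.trans (min_le_left _ _)⟩, hx.1,
    hx.2.trans (min_le_right _ _)⟩

/-- Along a timelike curve, the Euclidean distance is less than the elapsed conformal time. -/
theorem IsFutureTimelikeCurve.norm_sub_lt (ha : IsScaleFactor a)
    (h : IsFutureTimelikeCurve a U I γ) {s t : ℝ} (hs : s ∈ I) (ht : t ∈ I) (hst : s < t) :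
    ‖(γ t).2 - (γ s).2‖ < confTime a (γ s).1 - confTime a (γ t).1 := by
  -- Pairing with the direction `e` of the displacement gives a scalar function `⟪e, x⟫ + η`, which
  -- decreases strictly along the curve because `‖v.2‖ < v.1 / a`. If the displacement vanishes, `e
  -- = 0` serves.
  obtain ⟨e, he, hinner⟩ : ∃ e : Space n, ‖e‖ ≤ 1 ∧
      inner ℝ e ((γ t).2 - (γ s).2) = ‖(γ t).2 - (γ s).2‖ := by
    generalize (γ t).2 - (γ s).2 = x
    rcases eq_or_ne x 0 with rfl | hx
    · exact ⟨0, by simp⟩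
    · have hx' : ‖x‖ ≠ 0 := norm_ne_zero_iff.2 hx
      refine ⟨‖x‖⁻¹ • x, by simp [norm_smul, hx'], ?_⟩
      rw [real_inner_smul_left, real_inner_self_eq_norm_sq]
      field_simp
  have hsub : Icc s t ⊆ I := h.ordConnected.out hs ht
  have hcont := h.continuousOn.mono hsub
  have key := lt_of_right_deriv_neg hst
    (f := fun r => inner ℝ e (γ r).2 + confTime a (γ r).1)
    (f' := fun r => inner ℝ e (derivWithin γ (Ici r) r).2 +
      -(1 / a (γ r).1) * (derivWithin γ (Ici r) r).1)
    ((continuousOn_const.inner hcont.snd).add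
      (ha.contDiff_confTime.continuous.comp_continuousOn hcont.fst)) ?_ ?_
  · rw [inner_sub_right] at hinner
    linarith
  · intro r hr
    have hd := h.hasDerivWithinAt (hsub ⟨hr.1, hr.2.le⟩) ht hr.2
    have h1 := ((innerSL ℝ e).comp (ContinuousLinearMap.snd ℝ ℝ (Space n))).hasFDerivAt
      |>.comp_hasDerivWithinAt r hd
    have h2 := (ContinuousLinearMap.fst ℝ ℝ (Space n)).hasFDerivAt.comp_hasDerivWithinAt r hd
    exact h1.add ((ha.hasDerivAt_confTime (γ r).1).comp_hasDerivWithinAt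
      (h := fun r => (γ r).1) r h2)
  · intro r hr
    have hv := h.timelike_right r (hsub ⟨hr.1, hr.2.le⟩) ⟨t, ht, hr.2⟩
    have h1 := hv.norm_lt ha
    have h2 := real_inner_le_norm e (derivWithin γ (Ici r) r).2
    have h3 : ‖e‖ * ‖(derivWithin γ (Ici r) r).2‖ ≤ ‖(derivWithin γ (Ici r) r).2‖ :=
      mul_le_of_le_one_left (norm_nonneg _) he
    have h4 : -(1 / a (γ r).1) * (derivWithin γ (Ici r) r).1 =
      -((derivWithin γ (Ici r) r).1 / a (γ r).1) := by ring
    simp only [h4]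
    linarith

/-- This is the Minkowski light cone in the coordinates `(-η, x)`. It reduces all later arguments
about curves to this inequality. -/
theorem mem_chronFuture_iff (ha : IsScaleFactor a) {p q : ℝ × Space n} :
    q ∈ chronFuture a (M₁ n) p ↔
      q ∈ M₁ n ∧ ‖q.2 - p.2‖ < confTime a p.1 - confTime a q.1 := by
  constructor
  · rintro ⟨γ, hγ, rfl, rfl⟩
    exact ⟨hγ.mapsTo (by simp), hγ.norm_sub_lt ha (by simp) (by simp) one_pos⟩
  · rintro ⟨hq, hlt⟩
    obtain ⟨D, hD⟩ : ∃ D, D = confTime a p.1 - confTime a q.1 := ⟨_, rfl⟩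
    rw [← hD] at hlt
    have hD0 : 0 < D := (norm_nonneg _).trans_lt hlt
    have hpq : p.1 < q.1 := ha.strictAnti_confTime.lt_iff_gt.1 (by linarith)
    -- The straight segment in `(-η, x)`, parameterized affinely in `t`; its speed in conformal time
    -- is `‖q.2 - p.2‖ / D < 1`.
    obtain ⟨γ, hγ⟩ : ∃ γ : ℝ → ℝ × Space n, γ = fun l => (p.1 + l * (q.1 - p.1),
      p.2 + ((confTime a p.1 - confTime a (p.1 + l * (q.1 - p.1))) / D) • (q.2 - p.2)) := ⟨_, rfl⟩
    have hfst : ∀ l, (γ l).1 = p.1 + l * (q.1 - p.1) := fun l => by rw [hγ]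
    have hsm : ContDiff ℝ ∞ γ := by
      have h1 : ContDiff ℝ ∞ (fun l : ℝ => p.1 + l * (q.1 - p.1)) := by fun_prop
      have h2 := ha.contDiff_confTime.comp h1
      rw [hγ]
      exact h1.prodMk (contDiff_const.add
        (((contDiff_const.sub h2).div_const D).smul contDiff_const))
    have hder : ∀ l, HasDerivAt γ (q.1 - p.1,
        ((1 / a (γ l).1 * (q.1 - p.1)) / D) • (q.2 - p.2)) l := by
      intro l
      have h1 : HasDerivAt (fun l : ℝ => p.1 + l * (q.1 - p.1)) (q.1 - p.1) l := by
        simpa using ((hasDerivAt_id l).mul_const (q.1 - p.1)).const_add p.1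
      have h2 := (ha.hasDerivAt_confTime (p.1 + l * (q.1 - p.1))).comp l h1
      have h3 := (((h2.const_sub (confTime a p.1)).div_const D).smul_const
        (q.2 - p.2)).const_add p.2
      rw [hfst, hγ]
      rw [neg_mul, neg_neg] at h3
      exact h1.prodMk h3
    have htl : ∀ l, IsFutureTimelike a (γ l) (q.1 - p.1,
        ((1 / a (γ l).1 * (q.1 - p.1)) / D) • (q.2 - p.2)) := by
      intro l
      have ha' := ha.pos (γ l).1
      refine ⟨?_, by simpa [metric] using hpq⟩
      simp only [metric, real_inner_self_eq_norm_sq, norm_smul]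
      have e : a (γ l).1 ^ 2 * (‖1 / a (γ l).1 * (q.1 - p.1) / D‖ * ‖q.2 - p.2‖) ^ 2
          = (q.1 - p.1) ^ 2 * (‖q.2 - p.2‖ / D) ^ 2 := by
        rw [mul_pow, Real.norm_eq_abs, sq_abs]
        field_simp
      rw [e]
      have h1 : ‖q.2 - p.2‖ / D < 1 := (div_lt_one hD0).2 hlt
      have h0 : 0 ≤ ‖q.2 - p.2‖ / D := by positivity
      have h2 : (‖q.2 - p.2‖ / D) ^ 2 < 1 := by nlinarith
      have h3 : 0 < (q.1 - p.1) ^ 2 := pow_pos (sub_pos.2 hpq) 2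
      nlinarith
    refine ⟨γ, ⟨ordConnected_Icc, ⟨0, by simp, 1, by simp, by simp⟩, ?_, ?_, ?_, ?_⟩, ?_, ?_⟩
    · intro l hl
      have hq' : q.1 < 1 := hq
      show (γ l).1 < 1
      rw [hfst]
      nlinarith [hl.1, hl.2]
    · exact fun s _ => ⟨1, one_pos, hsm.contDiffOn, hsm.contDiffOn⟩
    · intro s _ _
      rw [(hder s).hasDerivWithinAt.derivWithin (uniqueDiffWithinAt_Ici s)]
      exact htl s
    · intro s _ _
      rw [(hder s).hasDerivWithinAt.derivWithin (uniqueDiffWithinAt_Iic s)]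
      exact htl s
    · rw [hγ]; simp
    · rw [hγ]
      simp [← hD, hD0.ne']

end Curves

/-! ### Half spaces bounded by null hyperplanes -/

section HalfSpace

variable {n : ℕ}

theorem inner_omega_self (p : ℝ × Space n) : inner ℝ (omega p) p.2 = ‖p.2‖ := by
  rw [omega, real_inner_smul_left, real_inner_self_eq_norm_sq]
  rcases eq_or_ne ‖p.2‖ 0 with h | h
  · simp [h]
  · field_simp

theorem norm_omega {p : ℝ × Space n} (hp : 0 < ‖p.2‖) : ‖omega p‖ = 1 := by
  rw [omega, norm_smul, norm_inv, norm_norm, inv_mul_cancel₀ hp.ne']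

theorem norm_omega_le (p : ℝ × Space n) : ‖omega p‖ ≤ 1 := by
  rw [omega, norm_smul, norm_inv, norm_norm]
  exact inv_mul_le_one

theorem norm_smul_omega (p : ℝ × Space n) : ‖p.2‖ • omega p = p.2 := by
  rcases eq_or_ne p.2 0 with h | h
  · simp [h]
  · rw [omega, smul_inv_smul₀ (norm_ne_zero_iff.2 h)]

/-- Second order expansion of the distance to a far away point. -/
theorem norm_sub_le_of_norm_pos {p : ℝ × Space n} (x : Space n) (hp : 0 < ‖p.2‖) :
    ‖x - p.2‖ ≤ ‖p.2‖ - inner ℝ (omega p) x + ‖x‖ ^ 2 / (2 * ‖p.2‖) := by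
  have hc : inner ℝ (omega p) x ≤ ‖x‖ :=
    (real_inner_le_norm _ _).trans (mul_le_of_le_one_left (norm_nonneg _) (norm_omega_le p))
  have hin : inner ℝ x p.2 = ‖p.2‖ * inner ℝ (omega p) x := by
    conv_lhs => rw [← norm_smul_omega p]
    rw [real_inner_smul_right, real_inner_comm]
  have hsq : ‖x - p.2‖ ^ 2 = ‖x‖ ^ 2 - 2 * (‖p.2‖ * inner ℝ (omega p) x) + ‖p.2‖ ^ 2 := by
    rw [norm_sub_sq_real, hin]
  generalize inner ℝ (omega p) x = c at *
  generalize ‖p.2‖ = r at *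
  generalize ‖x‖ = y at *
  -- Since `c ≤ y`, this expression bounds the right-hand side from below, so that side is
  -- nonnegative and the inequality may be squared. The difference of the squares is then the
  -- perfect square in `e2`.
  have e0 : r - y + y ^ 2 / (2 * r) = ((r - y) ^ 2 + r ^ 2) / (2 * r) := by
    field_simp
    ring
  have e1 : 0 ≤ r - y + y ^ 2 / (2 * r) := by rw [e0]; positivity
  refine le_of_sq_le_sq ?_ (by linarith)
  have e2 : (r - c + y ^ 2 / (2 * r)) ^ 2 - (y ^ 2 - 2 * (r * c) + r ^ 2) =
      (c - y ^ 2 / (2 * r)) ^ 2 := by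
    field_simp
    ring
  nlinarith [sq_nonneg (c - y ^ 2 / (2 * r))]

/-- The future of the point of past null infinity in the direction `w` on the null hyperplane
`⟪w, x⟫ - ∫_t^1 ds / a(s) = u`. -/
def halfSpace (a : ℝ → ℝ) (u : ℝ) (w : Space n) : Set (ℝ × Space n) :=
  {q | q ∈ M₁ n ∧ u < inner ℝ w q.2 - confTime a q.1}

theorem halfSpace_ssubset {a : ℝ → ℝ} {u v : ℝ} (huv : u < v) {w : Space n} (hw : ‖w‖ = 1) :
    halfSpace a v w ⊂ halfSpace a u w := by
  have hsub : halfSpace a v w ⊆ halfSpace a u w := fun q hq => ⟨hq.1, huv.trans hq.2⟩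
  -- The witness lies on the boundary hyperplane of the smaller half space, at `t = 0`.
  refine (ssubset_iff_of_subset hsub).2
    ⟨(0, (v + confTime a 0) • w), ⟨by simp [M₁], ?_⟩, fun h => ?_⟩
  · simpa [real_inner_smul_right, hw] using huv
  · simpa [real_inner_smul_right, hw] using h.2

theorem halfSpace_ne {a : ℝ → ℝ} {u v : ℝ} {w z : Space n} (hw : ‖w‖ = 1) (hz : ‖z‖ = 1)
    (hwz : w ≠ z) : halfSpace a u w ≠ halfSpace a v z := by
  intro h
  have hd : 0 < 1 - inner ℝ w z := by
    have := (inner_lt_one_iff_real_of_norm_eq_one hw hz).2 hwz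
    linarith
  -- Along `w - z` the two pairings are `c` and `-c`; a large `c` places `(0, x)` in the first half
  -- space and outside the second.
  obtain ⟨c, hc⟩ : ∃ c, c = |u| + |v| + |confTime a 0| + 1 := ⟨_, rfl⟩
  obtain ⟨x, hx⟩ : ∃ x, x = (c / (1 - inner ℝ w z)) • (w - z) := ⟨_, rfl⟩
  have h1 : inner ℝ w x = c := by
    rw [hx, real_inner_smul_right, inner_sub_right, real_inner_self_eq_norm_sq, hw]
    field_simp
  have h2 : inner ℝ z x = -c := by
    rw [hx, real_inner_smul_right, inner_sub_right, real_inner_self_eq_norm_sq, hz,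
      real_inner_comm w z]
    field_simp
    ring
  have hu := neg_abs_le u
  have hu' := le_abs_self u
  have hv := neg_abs_le v
  have hh := le_abs_self (confTime a 0)
  have hh' := neg_abs_le (confTime a 0)
  have hu0 := abs_nonneg u
  have hmem : ((0 : ℝ), x) ∈ halfSpace a u w := ⟨by simp [M₁], by
    show u < inner ℝ w x - confTime a 0
    linarith [abs_nonneg v]⟩
  rw [h] at hmem
  have : v < inner ℝ z x - confTime a 0 := hmem.2
  linarith

end HalfSpace

theorem IsScaleFactor.tendsto_norm {n : ℕ} {a : ℝ → ℝ} (ha : IsScaleFactor a)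
    {γ : ℝ → ℝ × Space n} {u : ℝ}
    (hu : Tendsto (fun t => ‖(γ t).2‖ - confTime a t) atBot (𝓝 u)) :
    Tendsto (fun t => ‖(γ t).2‖) atBot atTop :=
  (hu.add_atTop ha.no_particle_horizon).congr fun _ => sub_add_cancel _ _

/-! ### Past asymptotics of inextendible curves and their TIFs -/

namespace IsPastInextendibleTimelikeCurve

variable {n : ℕ} {a : ℝ → ℝ} {I : Set ℝ} {γ : ℝ → ℝ × Space n}
  (ha : IsScaleFactor a) (h : IsPastInextendibleTimelikeCurve a I γ)
include h

theorem lt_one {t : ℝ} (ht : t ∈ I) : t < 1 := by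
  have := h.curve.mapsTo ht
  rwa [M₁, mem_ofPred_eq, h.param t ht] at this

include ha

theorem norm_sub_le {s t : ℝ} (hs : s ∈ I) (ht : t ∈ I) (hst : s ≤ t) :
    ‖(γ t).2 - (γ s).2‖ ≤ confTime a s - confTime a t := by
  rcases hst.eq_or_lt with rfl | hlt
  · simp
  · have := h.curve.norm_sub_lt ha hs ht hlt
    rw [h.param s hs, h.param t ht] at this
    exact this.le

/-- At a finite lower end `η` converges, and it controls distances along the curve, so `x` would be
Cauchy and the curve would have an endpoint in `M₁`. -/
theorem not_bddBelow : ¬ BddBelow I := by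
  intro hb
  obtain ⟨t₀, ht₀⟩ := h.curve.nontrivial.nonempty
  have : Nonempty I := ⟨⟨t₀, ht₀⟩⟩
  have hlim : Tendsto (fun s : I => (s : ℝ)) atBot (𝓝 (sInf I)) := by
    have := tendsto_atBot_ciInf (f := fun s : I => (s : ℝ)) (fun _ _ hst => hst)
      (by simpa using hb)
    rwa [← sInf_eq_iInf' I] at this
  have hc := (ha.contDiff_confTime.continuous.tendsto (sInf I)).comp hlim
  have hx : Cauchy (map (fun s : I => (γ s).2) atBot) := by
    have hcau := hc.cauchy_map
    rw [Metric.cauchy_iff] at hcau ⊢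
    refine ⟨inferInstance, fun ε hε => ?_⟩
    obtain ⟨V, hV, hVε⟩ := hcau.2 ε hε
    refine ⟨_, image_mem_map (mem_map.1 hV), ?_⟩
    have key : ∀ s t : I, s ≤ t → confTime a s ∈ V → confTime a t ∈ V →
        dist (γ t).2 (γ s).2 < ε := by
      intro s t hst hs ht
      rw [dist_eq_norm]
      refine (h.norm_sub_le ha s.2 t.2 hst).trans_lt ((le_abs_self _).trans_lt ?_)
      exact hVε _ hs _ ht
    rintro _ ⟨s, hs, rfl⟩ _ ⟨t, ht, rfl⟩
    rcases le_total s t with hst | hst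
    · rw [dist_comm]; exact key s t hst hs ht
    · exact key t s hst ht hs
  obtain ⟨x, hx⟩ := cauchy_map_iff_exists_tendsto.1 hx
  refine h.inextendible (sInf I, x) ((csInf_le hb ht₀).trans_lt (h.lt_one ht₀)) ?_
  have hfst : Tendsto (fun s : I => (γ s).1) atBot (𝓝 (sInf I)) :=
    hlim.congr fun s => (h.param s s.2).symm
  exact hfst.prodMk_nhds hx

theorem eventually_mem : ∀ᶠ t in atBot, t ∈ I := by
  obtain ⟨t₀, ht₀⟩ := h.curve.nontrivial.nonempty
  filter_upwards [eventually_le_atBot t₀] with t ht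
  obtain ⟨s, hs, hst⟩ := not_bddBelow_iff.1 (h.not_bddBelow ha) t
  exact h.curve.ordConnected.out hs ht₀ ⟨hst.le, ht⟩

theorem norm_sub_confTime_mono {s t : ℝ} (hs : s ∈ I) (ht : t ∈ I) (hst : s ≤ t) :
    ‖(γ s).2‖ - confTime a s ≤ ‖(γ t).2‖ - confTime a t := by
  have h1 := h.norm_sub_le ha hs ht hst
  have h2 := norm_sub_norm_le (γ s).2 (γ t).2
  rw [norm_sub_rev] at h2
  linarith

theorem tendsto_T_sub : Tendsto
    (fun t => T a (γ t) - arctan (‖(γ t).2‖ - confTime a t)) atBot (𝓝 0) := by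
  have h1 : Tendsto (fun t => ‖(γ t).2‖ + confTime a t) atBot atTop :=
    tendsto_atTop_mono (fun _ => le_add_of_nonneg_left (norm_nonneg _)) ha.no_particle_horizon
  have h2 := (tendsto_arctan_atTop.mono_right nhdsWithin_le_nhds).comp h1
  have h3 := h2.const_sub (π / 2)
  rw [sub_self] at h3
  refine h3.congr' ?_
  filter_upwards [h.eventually_mem ha] with t ht
  rw [ha.T_eq (h.curve.mapsTo ht), h.param t ht]
  simp only [Function.comp_apply]
  ring

theorem tendsto_norm_sub_confTime {T' : ℝ} (hT' : T' ∈ Ioo (-(π / 2)) (π / 2))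
    (hT : Tendsto (fun t => T a (γ t)) atBot (𝓝 T')) :
    Tendsto (fun t => ‖(γ t).2‖ - confTime a t) atBot (𝓝 (tan T')) := by
  have h1 := hT.sub (h.tendsto_T_sub ha)
  simp only [sub_sub_cancel, sub_zero] at h1
  have h2 := ((continuousAt_tan.2 (cos_pos_of_mem_Ioo hT').ne').tendsto).comp h1
  simpa only [Function.comp_def, tan_arctan] using h2

theorem tendsto_norm_sub_confTime_or :
    Tendsto (fun t => ‖(γ t).2‖ - confTime a t) atBot atBot ∨
    ∃ u, Tendsto (fun t => ‖(γ t).2‖ - confTime a t) atBot (𝓝 u) := by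
  obtain ⟨t₀, ht₀⟩ := eventually_atBot.1 (h.eventually_mem ha)
  -- Freezing the curve after `t₀` makes the function monotone on all of `ℝ` without changing its
  -- germ at `-∞`.
  have hmono : Monotone fun t => ‖(γ (min t t₀)).2‖ - confTime a (min t t₀) := fun s t hst =>
    h.norm_sub_confTime_mono ha (ht₀ _ (min_le_right _ _)) (ht₀ _ (min_le_right _ _))
      (min_le_min_right _ hst)
  have heq : (fun t => ‖(γ (min t t₀)).2‖ - confTime a (min t t₀)) =ᶠ[atBot]
      fun t => ‖(γ t).2‖ - confTime a t := by
    filter_upwards [eventually_le_atBot t₀] with t ht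
    rw [min_eq_left ht]
  by_cases hb : BddBelow (range fun t => ‖(γ (min t t₀)).2‖ - confTime a (min t t₀))
  · exact Or.inr ⟨_, (tendsto_atBot_ciInf hmono hb).congr' heq⟩
  · refine Or.inl (Tendsto.congr' heq (tendsto_atBot_atBot.2 fun b => ?_))
    obtain ⟨_, ⟨s, rfl⟩, hs⟩ := not_bddBelow_iff.1 hb b
    exact ⟨s, fun t hts => (hmono hts).trans hs.le⟩

theorem TIF_eq_M₁ (hu : Tendsto (fun t => ‖(γ t).2‖ - confTime a t) atBot atBot) :
    TIF a I γ = M₁ n := by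
  refine Subset.antisymm (iUnion₂_subset fun t _ q hq => ((mem_chronFuture_iff ha).1 hq).1) ?_
  intro q hq
  obtain ⟨s, hs, hs'⟩ := ((h.eventually_mem ha).and
    (hu.eventually_lt_atBot (-(‖q.2‖ + confTime a q.1)))).exists
  refine mem_iUnion₂.2 ⟨s, hs, (mem_chronFuture_iff ha).2 ⟨hq, ?_⟩⟩
  rw [h.param s hs]
  linarith [_root_.norm_sub_le q.2 (γ s).2]

section Finite

variable {u : ℝ} (hu : Tendsto (fun t => ‖(γ t).2‖ - confTime a t) atBot (𝓝 u))
include hu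

theorem le_norm_sub_confTime {t : ℝ} (ht : t ∈ I) : u ≤ ‖(γ t).2‖ - confTime a t := by
  refine le_of_tendsto hu ?_
  filter_upwards [h.eventually_mem ha, eventually_le_atBot t] with s hs hst
  exact h.norm_sub_confTime_mono ha hs ht hst

/-- Cauchy–Schwarz gives `r(s) - ⟪ω(s), x(t)⟫ ≤ η(s) - η(t)`, and `r(s) ≥ u + η(s)`. -/
theorem le_inner_omega {s t : ℝ} (hs : s ∈ I) (ht : t ∈ I) (hst : s ≤ t) :
    u + confTime a t ≤ inner ℝ (omega (γ s)) (γ t).2 := by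
  have h1 := h.norm_sub_le ha hs ht hst
  have h2 : inner ℝ (omega (γ s)) ((γ s).2 - (γ t).2) ≤ ‖(γ s).2 - (γ t).2‖ :=
    (real_inner_le_norm _ _).trans (mul_le_of_le_one_left (norm_nonneg _) (norm_omega_le _))
  have h3 := h.le_norm_sub_confTime ha hu hs
  rw [inner_sub_right, inner_omega_self, norm_sub_rev] at h2
  linarith

/-- For unit vectors `‖ω(s) - ω(t)‖² = 2 - 2⟪ω(s), ω(t)⟫`, which `le_inner_omega` bounds by `2(r - η
- u)/r` at `t`. This tends to `0`, so `ω` is Cauchy. -/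
theorem exists_tendsto_omega : ∃ w : Metric.sphere (0 : Space n) 1,
    Tendsto (fun t => omega (γ t)) atBot (𝓝 (w : Space n)) := by
  have hr := ha.tendsto_norm hu
  have hg : Tendsto (fun t => 2 * (‖(γ t).2‖ - confTime a t - u) / ‖(γ t).2‖) atBot (𝓝 0) :=
    ((hu.sub_const u).const_mul 2).div_atTop hr
  have key : ∀ s t, s ∈ I → t ∈ I → s ≤ t → 0 < ‖(γ s).2‖ → 0 < ‖(γ t).2‖ →
      ‖omega (γ s) - omega (γ t)‖ ^ 2 ≤ 2 * (‖(γ t).2‖ - confTime a t - u) / ‖(γ t).2‖ := by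
    intro s t hs ht hst hs0 ht0
    have h1 := h.le_inner_omega ha hu hs ht hst
    rw [norm_sub_sq_real, norm_omega hs0, norm_omega ht0, le_div_iff₀ ht0]
    rw [← norm_smul_omega (γ t), real_inner_smul_right] at h1
    nlinarith
  have hcau : Cauchy (map (fun t => omega (γ t)) atBot) := by
    rw [Metric.cauchy_iff]
    refine ⟨inferInstance, fun ε hε => ?_⟩
    obtain ⟨t₀, ht₀⟩ := eventually_atBot.1 ((h.eventually_mem ha).and
      ((hr.eventually_gt_atTop 0).and (hg.eventually_lt_const (pow_pos hε 2))))
    refine ⟨_, image_mem_map (Iic_mem_atBot t₀), ?_⟩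
    have key' : ∀ s t, s ≤ t → s ≤ t₀ → t ≤ t₀ → dist (omega (γ s)) (omega (γ t)) < ε := by
      intro s t hst hs ht
      obtain ⟨hs1, hs2, -⟩ := ht₀ s hs
      obtain ⟨ht1, ht2, ht3⟩ := ht₀ t ht
      rw [dist_eq_norm]
      exact lt_of_pow_lt_pow_left₀ 2 hε.le ((key s t hs1 ht1 hst hs2 ht2).trans_lt ht3)
    rintro _ ⟨s, hs, rfl⟩ _ ⟨t, ht, rfl⟩
    rcases le_total s t with hst | hst
    · exact key' s t hst hs ht
    · rw [dist_comm]; exact key' t s hst ht hs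
  obtain ⟨w, hw⟩ := cauchy_map_iff_exists_tendsto.1 hcau
  refine ⟨⟨w, ?_⟩, hw⟩
  rw [mem_sphere_zero_iff_norm]
  refine tendsto_nhds_unique hw.norm (tendsto_const_nhds.congr' ?_)
  filter_upwards [hr.eventually_gt_atTop 0] with t ht
  exact (norm_omega ht).symm

/-- For `⊆`, let `s → -∞` in `le_inner_omega` and combine with the light cone of `γ t`. For `⊇`, the
expansion of the distance bounds `‖q.2 - x(t)‖ - η(t)` by a quantity tending to `u - ⟪w, q.2⟫ <
-η(q)`. -/
theorem TIF_eq_halfSpace {w : Space n} (hw1 : ‖w‖ = 1)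
    (hw : Tendsto (fun t => omega (γ t)) atBot (𝓝 w)) : TIF a I γ = halfSpace a u w := by
  have hr := ha.tendsto_norm hu
  ext q
  simp only [TIF, mem_iUnion₂, mem_chronFuture_iff ha, halfSpace, mem_ofPred_eq]
  constructor
  · rintro ⟨t, ht, hq, hlt⟩
    refine ⟨hq, ?_⟩
    have h1 : u + confTime a t ≤ inner ℝ w (γ t).2 := by
      refine ge_of_tendsto (hw.inner tendsto_const_nhds) ?_
      filter_upwards [h.eventually_mem ha, eventually_le_atBot t] with s hs hst
      exact h.le_inner_omega ha hu hs ht hst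
    have h2 := real_inner_le_norm w ((γ t).2 - q.2)
    rw [inner_sub_right, hw1, one_mul, norm_sub_rev] at h2
    rw [h.param t ht] at hlt
    linarith
  · rintro ⟨hq, hlt⟩
    have hlim : Tendsto (fun t => ‖(γ t).2‖ - confTime a t - inner ℝ (omega (γ t)) q.2 +
        ‖q.2‖ ^ 2 / (2 * ‖(γ t).2‖)) atBot (𝓝 (u - inner ℝ w q.2 + 0)) :=
      (hu.sub (hw.inner tendsto_const_nhds)).add
        (tendsto_const_nhds.div_atTop (hr.const_mul_atTop two_pos))
    obtain ⟨t, ht, ht0, htlt⟩ := ((h.eventually_mem ha).and ((hr.eventually_gt_atTop 0).and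
      (hlim.eventually_lt_const (show _ < -confTime a q.1 by linarith)))).exists
    refine ⟨t, ht, hq, ?_⟩
    rw [h.param t ht]
    linarith [norm_sub_le_of_norm_pos q.2 ht0]

end Finite

end IsPastInextendibleTimelikeCurve

end FLRW

theorem proposition2 (n : ℕ) (hn : 2 ≤ n) (a : ℝ → ℝ) (ha : FLRW.IsScaleFactor a) :
    -- (a)
    (∀ (I : Set ℝ) (γ : ℝ → ℝ × FLRW.Space n), FLRW.IsPastInextendibleTimelikeCurve a I γ →
      (∀ᶠ t in atBot, t ∈ I) ∧
      ∃ T' ∈ Ico (-(π / 2)) (π / 2),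
        Tendsto (fun t => FLRW.T a (γ t)) atBot (𝓝 T') ∧
        (T' = -(π / 2) → FLRW.TIF a I γ = FLRW.M₁ n) ∧
        (T' ∈ Ioo (-(π / 2)) (π / 2) → ∃ ω' : Metric.sphere (0 : FLRW.Space n) 1,
          Tendsto (fun t => FLRW.omega (γ t)) atBot (𝓝 (ω' : FLRW.Space n)))) ∧
    -- (b)
    (∀ (I₁ I₂ : Set ℝ) (γ₁ γ₂ : ℝ → ℝ × FLRW.Space n),
      FLRW.IsPastInextendibleTimelikeCurve a I₁ γ₁ →
      FLRW.IsPastInextendibleTimelikeCurve a I₂ γ₂ →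
      ∀ T₁ ∈ Ioo (-(π / 2)) (π / 2), ∀ T₂ ∈ Ioo (-(π / 2)) (π / 2),
      ∀ ω₁ ω₂ : Metric.sphere (0 : FLRW.Space n) 1,
      Tendsto (fun t => FLRW.T a (γ₁ t)) atBot (𝓝 T₁) →
      Tendsto (fun t => FLRW.T a (γ₂ t)) atBot (𝓝 T₂) →
      Tendsto (fun t => FLRW.omega (γ₁ t)) atBot (𝓝 (ω₁ : FLRW.Space n)) →
      Tendsto (fun t => FLRW.omega (γ₂ t)) atBot (𝓝 (ω₂ : FLRW.Space n)) →
      (T₁ = T₂ → ω₁ = ω₂ → FLRW.TIF a I₁ γ₁ = FLRW.TIF a I₂ γ₂) ∧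
      (T₁ < T₂ → ω₁ = ω₂ → FLRW.TIF a I₂ γ₂ ⊂ FLRW.TIF a I₁ γ₁) ∧
      (ω₁ ≠ ω₂ → FLRW.TIF a I₁ γ₁ ≠ FLRW.TIF a I₂ γ₂)) := by
  refine ⟨fun I γ h => ⟨h.eventually_mem ha, ?_⟩, ?_⟩
  · have hT := h.tendsto_T_sub ha
    rcases h.tendsto_norm_sub_confTime_or ha with hu | ⟨u, hu⟩
    · refine ⟨-(π / 2), ⟨le_rfl, by linarith [pi_pos]⟩, ?_, fun _ => h.TIF_eq_M₁ ha hu,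
        fun hT' => absurd hT'.1 (lt_irrefl _)⟩
      simpa using hT.add ((tendsto_arctan_atBot.mono_right nhdsWithin_le_nhds).comp hu)
    · refine ⟨arctan u, ⟨(neg_pi_div_two_lt_arctan u).le, arctan_lt_pi_div_two u⟩, ?_,
        fun hT' => absurd hT' (neg_pi_div_two_lt_arctan u).ne',
        fun _ => h.exists_tendsto_omega ha hu⟩
      simpa using hT.add ((continuous_arctan.tendsto u).comp hu)
  · intro I₁ I₂ γ₁ γ₂ h₁ h₂ T₁ hT₁ T₂ hT₂ ω₁ ω₂ l₁ l₂ w₁ w₂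
    have n₁ : ‖(ω₁ : FLRW.Space n)‖ = 1 := mem_sphere_zero_iff_norm.1 ω₁.2
    have n₂ : ‖(ω₂ : FLRW.Space n)‖ = 1 := mem_sphere_zero_iff_norm.1 ω₂.2
    rw [h₁.TIF_eq_halfSpace ha (h₁.tendsto_norm_sub_confTime ha hT₁ l₁) n₁ w₁,
      h₂.TIF_eq_halfSpace ha (h₂.tendsto_norm_sub_confTime ha hT₂ l₂) n₂ w₂]
    refine ⟨?_, ?_, fun hne => FLRW.halfSpace_ne n₁ n₂ fun he => hne (Subtype.ext he)⟩
    · rintro rfl rfl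
      rfl
    · rintro hlt rfl
      exact FLRW.halfSpace_ssubset (strictMonoOn_tan hT₁ hT₂ hlt) n₁
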